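/- Assume the continuum hypothesis, $\aleph_1=2^{\aleph_0}$. Then there is an infinite maximal almost disjoint (MAD) family $\mathcal F_+$ of infinite subsets of $\mathbb N$ such that the Johnson–Lindenstrauss space $JL_2(\mathcal F_+)$ has Efremov's property $(\mathcal E)$. Here an almost disjoint family is a family of infinite subsets of $\mathbb N$ any two distinct members of which have finite intersection, and it is MAD if it is maximal with respect to inclusion among almost disjoint families. For an almost disjoint family $\mathcal F$, the real Banach space $JL_2(\mathcal F)$ is the completion of $\operatorname{span}(c_0\cup\{\chi_N: N\in\mathcal F\})\subseteq\ell_\infty$ with respect to the norm $$\Bigl\|x+\sum_{r=1}^k a_r\chi_{N_r}\Bigr\| = \max\Bigl\{\Bigl\|x+\sum_{r=1}^k a_r\chi_{N_r}\Bigr\|_\infty,\ \Bigl(\sum_{r=1}^k a_r^2\Bigr)^{1/2}\Bigr\},$$ where $x\in c_0$, $N_1,\dots,N_k$ are distinct members of $\mathcal F$ and $a_1,\dots,a_k\in\mathbb R$. A real Banach space $X$ has property $(\mathcal E)$ if every element of the weak$^*$-closure of a convex norm-bounded set $C\subseteq X^*$ is the weak$^*$-limit of a sequence of elements of $C$. 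-/

import Mathlib

open Filter Topology
open scoped ENNReal

/-- A family of infinite subsets of `ℕ`, any two distinct members of which have finite
intersection. -/
def IsAlmostDisjointFamily (F : Set (Set ℕ)) : Prop :=
  (∀ N ∈ F, N.Infinite) ∧ ∀ N ∈ F, ∀ M ∈ F, N ≠ M → (N ∩ M).Finite

/-- A maximal almost disjoint family: an almost disjoint family that is maximal with respect to
inclusion among all almost disjoint families. -/
def IsMADFamily (F : Set (Set ℕ)) : Prop := Maximal IsAlmostDisjointFamily F

/-- Efremov's property (E): every element of the weak*-closure of a convex (norm-)bounded subset
`C` of the dual is the weak*-limit of a sequence of elements of `C`. -/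
def HasEfremovProperty (X : Type*) [NormedAddCommGroup X] [NormedSpace ℝ X] : Prop :=
  ∀ C : Set (StrongDual ℝ X), Convex ℝ C → Bornology.IsBounded C →
    ∀ f : StrongDual ℝ X,
      StrongDual.toWeakDual f ∈ closure (StrongDual.toWeakDual '' C : Set (WeakDual ℝ X)) →
      ∃ u : ℕ → StrongDual ℝ X, (∀ n, u n ∈ C) ∧
        Tendsto (fun n => (StrongDual.toWeakDual (u n) : WeakDual ℝ X)) atTop
          (𝓝 (StrongDual.toWeakDual f))

namespace JohnsonLindenstrauss

noncomputable section

/-- The Banach space `ℓ_∞` of bounded real sequences with the supremum norm. -/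
abbrev EllInfty : Type := lp (fun _ : ℕ => ℝ) ∞

/-- The subspace `c₀` of `ℓ_∞` of the sequences that converge to `0`. -/
def c0 : Submodule ℝ EllInfty where
  carrier := {x | Tendsto (fun n => x n) atTop (𝓝 0)}
  add_mem' := by
    intro x y hx hy
    have h := Filter.Tendsto.add hx hy
    simpa using h
  zero_mem' := by
    simp
  smul_mem' := by
    intro c x hx
    have h := Filter.Tendsto.const_mul c hx
    simpa using h

/-- The characteristic function of a set `N ⊆ ℕ`, as an element of `ℓ_∞`. -/
def chi (N : Set ℕ) : EllInfty :=
  ⟨N.indicator (fun _ => (1 : ℝ)), memℓp_infty ⟨1, by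
    rintro _ ⟨n, rfl⟩
    by_cases h : n ∈ N <;> simp [h]⟩⟩

theorem chi_apply (N : Set ℕ) (n : ℕ) : chi N n = N.indicator (fun _ => (1 : ℝ)) n := rfl

/-- The subspace `span (c₀ ∪ {χ_N : N ∈ F})` of `ℓ_∞`. -/
def jlSpan (F : Set (Set ℕ)) : Submodule ℝ EllInfty :=
  Submodule.span ℝ ((c0 : Set EllInfty) ∪ chi '' F)

/-- The map `(x, (a_N)) ↦ x + ∑ a_N χ_N`, where `x ∈ c₀` and `(a_N)` is a finitely supported
family of real numbers indexed by `F`. -/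
def jlMap (F : Set (Set ℕ)) : (c0 × (F →₀ ℝ)) →ₗ[ℝ] EllInfty :=
  c0.subtype.coprod (Finsupp.linearCombination ℝ (fun N : F => chi N))

theorem jlMap_apply (F : Set (Set ℕ)) (x : c0) (a : F →₀ ℝ) :
    jlMap F (x, a) = (x : EllInfty) + a.sum (fun N t => t • chi (N : Set ℕ)) := by
  simp [jlMap, Finsupp.linearCombination_apply]

theorem range_jlMap (F : Set (Set ℕ)) : LinearMap.range (jlMap F) = jlSpan F := by
  have h : Set.range (fun N : F => chi N) = chi '' F := by
    ext y; simp
  rw [jlMap, LinearMap.range_coprod, Finsupp.range_linearCombination, jlSpan,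
    Submodule.span_union, Submodule.span_eq, Submodule.range_subtype, h]

/-- For an almost disjoint family, the element of `c₀` and the coefficients `a_N` are determined
by the sum `x + ∑ a_N χ_N`. -/
theorem jlMap_injective {F : Set (Set ℕ)} (hF : IsAlmostDisjointFamily F) :
    Function.Injective (jlMap F) := by
  rw [injective_iff_map_eq_zero]
  rintro ⟨x, a⟩ h
  have key : a = 0 := by
    ext M
    by_contra hM
    have hM' : a M ≠ 0 := by simpa using hM
    have hfin : (⋃ N ∈ {N | N ∈ a.support ∧ N ≠ M}, ((M : Set ℕ) ∩ N)).Finite := by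
      refine Set.Finite.biUnion (a.support.finite_toSet.subset fun N hN => hN.1) ?_
      intro N hN
      exact hF.2 M M.2 N N.2 (fun e => hN.2 (Subtype.ext e.symm))
    have hx : Tendsto (fun n => (x : EllInfty) n) atTop (𝓝 0) := x.2
    have hev : ∀ᶠ n in atTop, |(x : EllInfty) n| < |a M| := by
      have := hx.abs
      rw [abs_zero] at this
      exact this.eventually (gt_mem_nhds (abs_pos.2 hM'))
    have hev2 : ∀ᶠ n in atTop,
        n ∉ (⋃ N ∈ {N | N ∈ a.support ∧ N ≠ M}, ((M : Set ℕ) ∩ N)) := by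
      rw [← Nat.cofinite_eq_atTop]
      exact hfin.compl_mem_cofinite
    obtain ⟨n, hnM, hn1, hn2⟩ :=
      ((Nat.frequently_atTop_iff_infinite.2 (hF.1 M M.2)).and_eventually (hev.and hev2)).exists
    have hval : (jlMap F (x, a)) n = (x : EllInfty) n + a M := by
      have hs : (a.sum (fun N t => t • chi (N : Set ℕ)) : EllInfty) n = a M := by
        rw [Finsupp.sum, lp.coeFn_sum, Finset.sum_apply]
        rw [Finset.sum_eq_single_of_mem M (by simpa using hM')]
        · rw [lp.coeFn_smul, Pi.smul_apply, chi_apply, Set.indicator_of_mem hnM]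
          simp
        · intro N hN hNM
          have : n ∉ (N : Set ℕ) := by
            intro hnN
            exact hn2 (Set.mem_biUnion (show N ∈ {N | N ∈ a.support ∧ N ≠ M} from ⟨hN, hNM⟩)
              ⟨hnM, hnN⟩)
          rw [lp.coeFn_smul, Pi.smul_apply, chi_apply, Set.indicator_of_notMem this]
          simp
      rw [jlMap_apply, lp.coeFn_add, Pi.add_apply, hs]
    rw [h] at hval
    have h0 : (x : EllInfty) n = - a M := by
      have : (0 : ℝ) = (x : EllInfty) n + a M := by simpa using hval
      linarith
    rw [h0, abs_neg] at hn1
    exact lt_irrefl _ hn1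
  subst key
  have hx : (x : EllInfty) = 0 := by
    simpa [jlMap_apply] using h
  rw [Prod.mk_eq_zero]
  exact ⟨Subtype.ext hx, rfl⟩

/-- The subspace `span (c₀ ∪ {χ_N : N ∈ F})` as a bare real vector space, without the norm that it
inherits from `ℓ_∞`; it will carry the Johnson-Lindenstrauss norm. -/
def JLPre (F : Set (Set ℕ)) (_hF : IsAlmostDisjointFamily F) : Type := jlSpan F

variable {F : Set (Set ℕ)} (hF : IsAlmostDisjointFamily F)

instance : AddCommGroup (JLPre F hF) := inferInstanceAs (AddCommGroup (jlSpan F))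

instance : Module ℝ (JLPre F hF) := inferInstanceAs (Module ℝ (jlSpan F))

/-- The inclusion of `span (c₀ ∪ {χ_N : N ∈ F})` in `ℓ_∞`. -/
def JLPre.incl : JLPre F hF →ₗ[ℝ] EllInfty := (jlSpan F).subtype

/-- The unique representation of the elements of `span (c₀ ∪ {χ_N : N ∈ F})` as `x + ∑ a_N χ_N`. -/
def JLPre.repr : JLPre F hF ≃ₗ[ℝ] (c0 × (F →₀ ℝ)) :=
  ((LinearEquiv.ofInjective (jlMap F) (jlMap_injective hF)).trans
    (LinearEquiv.ofEq _ _ (range_jlMap F))).symm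

theorem JLPre.jlMap_repr (y : JLPre F hF) : jlMap F (JLPre.repr hF y) = JLPre.incl hF y := by
  obtain ⟨p, rfl⟩ := (JLPre.repr hF).symm.surjective y
  rw [LinearEquiv.apply_symm_apply]
  rfl

/-- The coefficients `a_N` of `y = x + ∑ a_N χ_N`. -/
def JLPre.coeff : JLPre F hF →ₗ[ℝ] (F →₀ ℝ) :=
  (LinearMap.snd ℝ c0 (F →₀ ℝ)).comp (JLPre.repr hF).toLinearMap

/-- The `ℓ₂`-norm `(∑ a_N²)^(1/2)` of a finitely supported family. -/
def l2norm {ι : Type*} (a : ι →₀ ℝ) : ℝ := Real.sqrt (a.sum fun _ t => t ^ 2)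

theorem l2norm_eq_of_subset {ι : Type*} (a : ι →₀ ℝ) (s : Finset ι) (hs : a.support ⊆ s) :
    l2norm a = (∑ i ∈ s, |a i| ^ (2 : ℝ)) ^ (1 / (2 : ℝ)) := by
  rw [l2norm, Finsupp.sum_of_support_subset a hs _ (by simp), Real.sqrt_eq_rpow]
  simp

theorem l2norm_add_le {ι : Type*} (a b : ι →₀ ℝ) : l2norm (a + b) ≤ l2norm a + l2norm b := by
  classical
  rw [l2norm_eq_of_subset (a + b) (a.support ∪ b.support) Finsupp.support_add,
    l2norm_eq_of_subset a (a.support ∪ b.support) Finset.subset_union_left,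
    l2norm_eq_of_subset b (a.support ∪ b.support) Finset.subset_union_right]
  exact Real.Lp_add_le _ _ _ (by norm_num)

theorem l2norm_smul {ι : Type*} (c : ℝ) (a : ι →₀ ℝ) : l2norm (c • a) = |c| * l2norm a := by
  have h : ((c • a).sum fun _ t => t ^ 2) = c ^ 2 * (a.sum fun _ t => t ^ 2) := by
    rw [Finsupp.sum_of_support_subset (c • a) Finsupp.support_smul _ (by simp), Finsupp.sum,
      Finset.mul_sum]
    refine Finset.sum_congr rfl fun i _ => ?_
    simp [mul_pow]
  rw [l2norm, h, Real.sqrt_mul (sq_nonneg c), Real.sqrt_sq_eq_abs, l2norm]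

/-- The Johnson-Lindenstrauss norm:
`‖x + ∑ a_N χ_N‖ = max (‖x + ∑ a_N χ_N‖_∞) ((∑ a_N²)^(1/2))`. -/
instance : Norm (JLPre F hF) :=
  ⟨fun y => max ‖JLPre.incl hF y‖ (l2norm (JLPre.coeff hF y))⟩

theorem JLPre.norm_def (y : JLPre F hF) :
    ‖y‖ = max ‖JLPre.incl hF y‖ (l2norm (JLPre.coeff hF y)) := rfl

theorem JLPre.normCore : NormedSpace.Core ℝ (JLPre F hF) where
  norm_nonneg y := le_max_of_le_left (norm_nonneg _)
  norm_smul c y := by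
    rw [JLPre.norm_def, JLPre.norm_def, map_smul, map_smul, norm_smul, l2norm_smul,
      Real.norm_eq_abs, mul_max_of_nonneg _ _ (abs_nonneg c)]
  norm_triangle y z := by
    rw [JLPre.norm_def, JLPre.norm_def, JLPre.norm_def, map_add, map_add]
    exact max_le
      ((norm_add_le _ _).trans (add_le_add (le_max_left _ _) (le_max_left _ _)))
      ((l2norm_add_le _ _).trans (add_le_add (le_max_right _ _) (le_max_right _ _)))
  norm_eq_zero_iff y := by
    constructor
    · intro h
      have h1 : ‖JLPre.incl hF y‖ ≤ 0 := h ▸ le_max_left _ _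
      have h2 : JLPre.incl hF y = 0 := norm_le_zero_iff.1 h1
      exact Subtype.ext h2
    · rintro rfl
      rw [JLPre.norm_def, map_zero, map_zero]
      simp [l2norm]

instance : NormedAddCommGroup (JLPre F hF) := NormedAddCommGroup.ofCore (JLPre.normCore hF)

instance : NormedSpace ℝ (JLPre F hF) := NormedSpace.ofCore (JLPre.normCore hF)

/-- The norm in the form in which it is usually written. -/
theorem JLPre.norm_repr_symm (x : c0) (a : F →₀ ℝ) :
    ‖(JLPre.repr hF).symm (x, a)‖ =
      max ‖(x : EllInfty) + a.sum (fun N t => t • chi (N : Set ℕ))‖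
        (Real.sqrt (a.sum fun _ t => t ^ 2)) := by
  rw [JLPre.norm_def, ← JLPre.jlMap_repr, JLPre.coeff, LinearMap.comp_apply,
    LinearEquiv.coe_coe, LinearEquiv.apply_symm_apply, jlMap_apply]
  rfl

/-- The Johnson-Lindenstrauss space `JL₂(F)` of an almost disjoint family `F`: the completion of
`span (c₀ ∪ {χ_N : N ∈ F})` in the Johnson-Lindenstrauss norm. -/
abbrev JL2 (F : Set (Set ℕ)) (hF : IsAlmostDisjointFamily F) : Type :=
  UniformSpace.Completion (JLPre F hF)

end

end JohnsonLindenstrauss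

/-! Translate the convex set so that the limit point is `0`. A functional `ψ` is determined by its
values at the unit vectors `e_n`, which lie in `ℓ₁`, and by its values at the `χ_N`. Replace the
latter by the residuals `ψ(χ_N) - ∑_{n ∈ N} ψ(e_n)`: then all `ψ(e_n)` and all residuals together
form a vector of `ℓ₂(ℕ ⊕ F)` of norm at most `‖ψ‖` (`sum_sq_le`).

In this Hilbert space, nested bounded convex sets have a common point in their closures
(`exists_mem_closure_of_antitone_convex`). Hence some vector `h` is approximated in norm by
coordinates of elements of `C` that are at the same time weak* close to `0`; it vanishes at the
coordinates from `ℕ` (`exists_dualCoord_limit`). A sequence in `C` whose coordinates converge to `h`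
is weak* null as soon as `∑_{n ∈ N} ψ_m(e_n)` tends to `-h_N` for every `N ∈ F`. Only countably many
`h_N` are nonzero, and as `ℓ₁` is separable, `ψ_m` may be sought in a countable set depending on
`m`.

What remains is combinatorial (`exists_isMADFamily_selection`). For countably many `N` a diagonal
choice suffices. Under CH the family is built in `ω₁` steps with a bookkeeping of all possible
tasks. A task met at stage `i` is solved on the countably many members present, and every later
member is chosen so thin that the sums over it of all solutions found so far tend to `0`. This is
the required limit if the support of the target is already present, and each task recurs uncountably
often, hence also after that moment. Thin sets can be found inside any infinite set, so maximality
is achieved by the same recursion. -/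

/-! ### Null sequences summed over thin sets. -/

/-- Every infinite set of natural numbers has an infinite subset on which each of countably many
given null sequences is absolutely summable. -/
theorem exists_infinite_subset_forall_summable (u : ℕ → ℕ → ℝ)
    (hu : ∀ i, Tendsto (u i) atTop (𝓝 0)) {A : Set ℕ} (hA : A.Infinite) :
    ∃ N ⊆ A, N.Infinite ∧ ∀ i, Summable (N.indicator fun n => |u i n|) := by
  have hfreq : ∀ j : ℕ, ∃ᶠ n in atTop, n ∈ A ∧ ∀ i ≤ j, |u i n| < (1 / 2 : ℝ) ^ j := by
    intro j
    refine (Nat.frequently_atTop_iff_infinite.2 hA).and_eventually ?_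
    refine (Set.finite_Iic j).eventually_all.2 fun i _ => ?_
    have := (hu i).abs
    rw [abs_zero] at this
    exact this.eventually (gt_mem_nhds (by positivity))
  obtain ⟨φ, hφ, h⟩ := extraction_forall_of_frequently hfreq
  refine ⟨Set.range φ, ?_, Set.infinite_range_of_injective hφ.injective, fun i => ?_⟩
  · rintro _ ⟨j, rfl⟩
    exact (h j).1
  · rw [← summable_subtype_iff_indicator, ← (Equiv.ofInjective φ hφ.injective).summable_iff]
    -- The geometric bound controls `u i` only from the `i`-th selected point on.
    rw [← summable_nat_add_iff i]
    refine Summable.of_nonneg_of_le (fun _ => abs_nonneg _) (fun j => ?_)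
      ((summable_nat_add_iff i).2 (summable_geometric_of_lt_one (r := 1 / 2) (by norm_num)
        (by norm_num)))
    exact ((h (j + i)).2 i (Nat.le_add_left _ _)).le

/-- A sequence of null sequences that converges uniformly to zero is uniformly null. -/
theorem tendsto_iSup_abs_of_uniformly_null {b : ℕ → ℕ → ℝ} (hb : ∀ m, Tendsto (b m) atTop (𝓝 0))
    (hb' : ∀ m n, |b m n| ≤ 1 / ((m : ℝ) + 1)) :
    ∃ u : ℕ → ℝ, Tendsto u atTop (𝓝 0) ∧ ∀ m n, |b m n| ≤ u n := by
  have hbdd : ∀ n, BddAbove (Set.range fun m => |b m n|) := fun n => ⟨1, by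
    rintro _ ⟨m, rfl⟩
    exact (hb' m n).trans ((div_le_one (by positivity)).2 (by linarith [m.cast_nonneg (α := ℝ)]))⟩
  refine ⟨fun n => ⨆ m, |b m n|, ?_, fun m n => le_ciSup (hbdd n) m⟩
  rw [Metric.tendsto_atTop']
  intro ε hε
  obtain ⟨k, hk⟩ := exists_nat_one_div_lt (half_pos hε)
  have : ∀ᶠ n in atTop, ∀ m ∈ Set.Iio k, |b m n| < ε / 2 := by
    refine (Set.finite_Iio k).eventually_all.2 fun m _ => ?_
    have := (hb m).abs
    rw [abs_zero] at this
    exact this.eventually (gt_mem_nhds (half_pos hε))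
  obtain ⟨n₀, hn₀⟩ := eventually_atTop.1 this
  refine ⟨n₀, fun n hn => ?_⟩
  have h0 : 0 ≤ ⨆ m, |b m n| := Real.iSup_nonneg fun _ => abs_nonneg _
  rw [Real.dist_0_eq_abs, abs_of_nonneg h0]
  refine lt_of_le_of_lt (ciSup_le fun m => ?_) (half_lt_self hε)
  rcases lt_or_ge m k with hm | hm
  · exact (hn₀ n hn.le m hm).le
  · refine (hb' m n).trans (le_trans ?_ hk.le)
    gcongr

/-- Sums over a thin set of a uniformly small sequence of null sequences tend to zero. -/
theorem exists_infinite_subset_forall_tendsto_tsum {B : Set (ℕ → ℕ → ℝ)} (hB : B.Countable)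
    (h0 : ∀ b ∈ B, ∀ m, Tendsto (b m) atTop (𝓝 0))
    (h1 : ∀ b ∈ B, ∀ m n, |b m n| ≤ 1 / ((m : ℝ) + 1)) {A : Set ℕ} (hA : A.Infinite) :
    ∃ N ⊆ A, N.Infinite ∧
      ∀ b ∈ B, Tendsto (fun m => ∑' n, N.indicator (b m) n) atTop (𝓝 0) := by
  rcases B.eq_empty_or_nonempty with rfl | hne
  · exact ⟨A, subset_rfl, hA, by simp⟩
  obtain ⟨e, rfl⟩ := hB.exists_eq_range hne
  choose u hu hbu using fun i => tendsto_iSup_abs_of_uniformly_null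
    (h0 (e i) ⟨i, rfl⟩) (h1 (e i) ⟨i, rfl⟩)
  obtain ⟨N, hNA, hN, hs⟩ := exists_infinite_subset_forall_summable u hu hA
  refine ⟨N, hNA, hN, ?_⟩
  rintro _ ⟨i, rfl⟩
  -- The envelope `u i` of the `i`-th system, summable over `N`, dominates; the bound `1 / (m + 1)`
  -- gives the pointwise limit.
  have := tendsto_tsum_of_dominated_convergence (𝓕 := atTop)
    (f := fun m n => N.indicator (e i m) n) (g := fun _ => (0 : ℝ)) (hs i) ?_ ?_
  · simpa using this
  · intro n
    refine squeeze_zero_norm (a := fun m : ℕ => 1 / ((m : ℝ) + 1)) (fun m => ?_)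
      tendsto_one_div_add_atTop_nhds_zero_nat
    exact (norm_indicator_le_norm_self _ _).trans (h1 (e i) ⟨i, rfl⟩ m n)
  · refine Eventually.of_forall fun m n => ?_
    by_cases hn : n ∈ N
    · simpa [hn] using (hbu i m n).trans (le_abs_self _)
    · simp [hn]

/-! ### Well-orders, diagonal selection and coding of tasks. -/

/-- Any type of cardinality `ℵ₁` carries a well-order with countable initial segments. -/
theorem exists_wellOrder_countable_Iic {ι : Type} (h : Cardinal.mk ι = Cardinal.aleph 1) :
    ∃ (_ : LinearOrder ι) (_ : WellFoundedLT ι), ∀ i : ι, (Set.Iic i).Countable := by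
  obtain ⟨lo, wf, ho⟩ := Cardinal.exists_ord_eq_type_lt ι
  refine ⟨lo, wf, fun i => ?_⟩
  have h1 := Cardinal.mk_Iio_lt i ho
  rw [h, ← Cardinal.succ_aleph0, Order.lt_succ_iff, Cardinal.le_aleph0_iff_set_countable] at h1
  rw [← Set.Iio_insert]
  exact h1.insert i

/-- A recursion along a well-order in which every value depends on the sets of values taken on
proper initial segments. -/
theorem exists_wellFounded_recursion {ι α : Type*} [LinearOrder ι] [WellFoundedLT ι]
    (step : ι → (ι → Set α) → α) :
    ∃ N : ι → α, ∀ i, N i = step i fun k => N '' {l | l < i ∧ l < k} := by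
  have wf : WellFounded ((· < ·) : ι → ι → Prop) := wellFounded_lt
  refine ⟨wf.fix fun i h => step i fun k => {x | ∃ l, ∃ hl : l < i, l < k ∧ h l hl = x},
    fun i => ?_⟩
  rw [wf.fix_eq]
  congr 1
  ext k x
  simp only [Set.mem_ofPred_eq, Set.mem_image, exists_prop, and_assoc]

/-- A diagonal selection: if finitely many target values can be approximated at every level, then
countably many can be attained in the limit. -/
theorem exists_selection_tendsto {α : Type*} (s : ℕ → ℕ → α → ℝ) (τ : α → ℝ) {G : Set α}
    (hG : G.Countable)
    (h : ∀ m, ∀ S : Finset α, (S : Set α) ⊆ G → ∀ ε > 0, ∃ j, ∀ N ∈ S, |s m j N - τ N| < ε) :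
    ∃ j : ℕ → ℕ, ∀ N ∈ G, Tendsto (fun m => s m (j m) N) atTop (𝓝 (τ N)) := by
  classical
  rcases G.eq_empty_or_nonempty with rfl | hne
  · exact ⟨0, by simp⟩
  obtain ⟨e, rfl⟩ := hG.exists_eq_range hne
  have hj : ∀ m : ℕ, ∃ j, ∀ i ≤ m, |s m j (e i) - τ (e i)| < 1 / ((m : ℝ) + 1) := by
    intro m
    obtain ⟨j, hj⟩ := h m ((Finset.range (m + 1)).image e) (by
      intro x hx
      obtain ⟨i, -, rfl⟩ := Finset.mem_image.1 hx
      exact ⟨i, rfl⟩) (1 / ((m : ℝ) + 1)) (by positivity)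
    exact ⟨j, fun i hi => hj _ (Finset.mem_image_of_mem _ (Finset.mem_range.2 (by omega)))⟩
  choose j hj using hj
  refine ⟨j, ?_⟩
  rintro _ ⟨i, rfl⟩
  rw [tendsto_iff_norm_sub_tendsto_zero]
  refine squeeze_zero' (Eventually.of_forall fun _ => norm_nonneg _) ?_
    (tendsto_one_div_add_atTop_nhds_zero_nat (𝕜 := ℝ))
  filter_upwards [eventually_ge_atTop i] with m hm
  exact (hj m i hm).le

/-- The real function on a type that is coded by a sequence of points with values. -/
noncomputable def codedFun {α : Type*} (p : ℕ → α × ℝ) (x : α) : ℝ :=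
  open scoped Classical in if h : ∃ i, (p i).1 = x then (p h.choose).2 else 0

/-- Countable support lets a sequence carry the target function, so that there are only continuum
many tasks. The point `x₀` is added so that an enumeration exists even when the support is empty. -/
theorem exists_codedFun_eq {α : Type*} {F : Set α} (hF : F.Nonempty) (τ : α → ℝ)
    (hτ : (F ∩ {x | τ x ≠ 0}).Countable) :
    ∃ p : ℕ → α × ℝ, (∀ i, (p i).1 ∈ F) ∧ ∀ x ∈ F, codedFun p x = τ x := by
  obtain ⟨x₀, hx₀⟩ := hF
  obtain ⟨e, he⟩ := (hτ.insert x₀).exists_eq_range (Set.insert_nonempty _ _)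
  refine ⟨fun i => (e i, τ (e i)), fun i => ?_, fun x hx => ?_⟩
  · have : e i ∈ insert x₀ (F ∩ {x | τ x ≠ 0}) := he ▸ ⟨i, rfl⟩
    rcases this with h | h
    · simpa [show e i = x₀ from h] using hx₀
    · exact h.1
  · unfold codedFun
    split_ifs with h
    · exact congrArg τ h.choose_spec
    · by_contra hne
      have : x ∈ Set.range e := he ▸ Or.inr ⟨hx, fun h0 => hne h0.symm⟩
      obtain ⟨i, hi⟩ := this
      exact h ⟨i, hi⟩

theorem codedFun_eq_zero {α : Type*} {p : ℕ → α × ℝ} {x : α} (h : ∀ i, (p i).1 ≠ x) :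
    codedFun p x = 0 := by
  unfold codedFun
  rw [dif_neg]
  rintro ⟨i, hi⟩
  exact h i hi

/-- The classes of a partition of `ℕ` into infinitely many infinite sets. -/
def unpairClass (i : ℕ) : Set ℕ := {n | n.unpair.1 = i}

theorem unpairClass_infinite (i : ℕ) : (unpairClass i).Infinite := by
  refine Set.infinite_of_injective_forall_mem (f := fun j => Nat.pair i j) ?_ ?_
  · intro j k h
    simpa using h
  · intro j
    simp [unpairClass]

theorem unpairClass_inter {i j : ℕ} (h : i ≠ j) : unpairClass i ∩ unpairClass j = ∅ := by
  ext n
  simp only [unpairClass, Set.mem_inter_iff, Set.mem_ofPred_eq, Set.mem_empty_iff_false, iff_false]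
  rintro ⟨rfl, rfl⟩
  exact h rfl

theorem unpairClass_injective : Function.Injective unpairClass := by
  intro i j h
  by_contra hij
  have := unpairClass_inter hij
  rw [h, Set.inter_self] at this
  exact (unpairClass_infinite j).nonempty.ne_empty this

/-- Under the continuum hypothesis, every type `α` with at most continuum many elements is coded
by a well-order with countable initial segments in which every element of `α` has uncountably many
codes. -/
theorem exists_wellOrder_code (CH : Cardinal.aleph.{0} 1 = Cardinal.continuum.{0}) (α : Type)
    (hα : Cardinal.mk (α × ℝ) = Cardinal.continuum) :
    ∃ (ι : Type) (_ : LinearOrder ι) (_ : WellFoundedLT ι) (code : ι → α),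
      (∀ i : ι, (Set.Iic i).Countable) ∧ ∀ a, ¬ (code ⁻¹' {a}).Countable := by
  obtain ⟨ι, e, hι⟩ : ∃ (ι : Type) (_ : ι ≃ α × ℝ), Cardinal.mk ι = Cardinal.aleph 1 :=
    ⟨_, Equiv.refl _, hα.trans CH.symm⟩
  obtain ⟨lo, wf, h⟩ := exists_wellOrder_countable_Iic hι
  refine ⟨ι, lo, wf, fun i => (e i).1, h, fun a ha => ?_⟩
  -- The real coordinate is a dummy whose only role is to repeat every `a` uncountably often.
  have hinj : Function.Injective fun r : ℝ => e.symm (a, r) := fun r s h => by simpa using h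
  refine Cardinal.not_countable_real ?_
  refine Set.countable_of_injective_of_countable_image hinj.injOn (ha.mono ?_)
  rintro _ ⟨r, -, rfl⟩
  simp

/-! ### Construction of the family. -/

/-- Under the continuum hypothesis there is an infinite maximal almost disjoint family with the
following property: if at every level `m` a sequence `D m` of null sequences bounded by
`1 / (m + 1)` has sums over finitely many members of the family approximating prescribed values,
all but countably many of which vanish, then one can choose a term of `D m` at every level `m` so
that the sums over every member of the family converge to the prescribed value. -/
theorem exists_isMADFamily_selection (CH : Cardinal.aleph.{0} 1 = Cardinal.continuum.{0}) :
    ∃ F : Set (Set ℕ), IsMADFamily F ∧ F.Infinite ∧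
      ∀ D : ℕ → ℕ → ℕ → ℝ, (∀ m j, Tendsto (D m j) atTop (𝓝 0)) →
        (∀ m j n, |D m j n| ≤ 1 / ((m : ℝ) + 1)) →
        ∀ τ : Set ℕ → ℝ, (F ∩ {N | τ N ≠ 0}).Countable →
        (∀ m, ∀ S : Finset (Set ℕ), (S : Set (Set ℕ)) ⊆ F → ∀ ε > 0,
          ∃ j, ∀ N ∈ S, |∑' n, N.indicator (D m j) n - τ N| < ε) →
        ∃ j : ℕ → ℕ, ∀ N ∈ F,
          Tendsto (fun m => ∑' n, N.indicator (D m (j m)) n) atTop (𝓝 (τ N)) := by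
  classical
  -- A task consists of a system of sequences, a coded target function, and a set to be tested for
  -- maximality.
  obtain ⟨ι, lo, wf, code, hIic, hcode⟩ := exists_wellOrder_code CH
    ((ℕ → ℕ → ℕ → ℝ) × (ℕ → Set ℕ × ℝ) × Set ℕ) (by simp [Cardinal.mk_real])
  set F₀ : Set (Set ℕ) := Set.range unpairClass with hF₀
  -- `b` solves task `i` on the members `G` when that is possible and is `0` otherwise. In both
  -- cases it is uniformly null, so later members can be made thin for it unconditionally.
  have hpick : ∀ (i : ι) (G : Set (Set ℕ)), ∃ b : ℕ → ℕ → ℝ,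
      (∀ m, Tendsto (b m) atTop (𝓝 0)) ∧ (∀ m n, |b m n| ≤ 1 / ((m : ℝ) + 1)) ∧
      (((∀ m j, Tendsto ((code i).1 m j) atTop (𝓝 0)) ∧
          (∀ m j n, |(code i).1 m j n| ≤ 1 / ((m : ℝ) + 1)) ∧
          ∃ j : ℕ → ℕ, ∀ N ∈ G, Tendsto (fun m => ∑' n, N.indicator ((code i).1 m (j m)) n) atTop
            (𝓝 (codedFun (code i).2.1 N))) →
        (∃ j : ℕ → ℕ, ∀ m, b m = (code i).1 m (j m)) ∧
          ∀ N ∈ G, Tendsto (fun m => ∑' n, N.indicator (b m) n) atTop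
            (𝓝 (codedFun (code i).2.1 N))) := by
    intro i G
    by_cases h : ((∀ m j, Tendsto ((code i).1 m j) atTop (𝓝 0)) ∧
          (∀ m j n, |(code i).1 m j n| ≤ 1 / ((m : ℝ) + 1)) ∧
          ∃ j : ℕ → ℕ, ∀ N ∈ G, Tendsto (fun m => ∑' n, N.indicator ((code i).1 m (j m)) n) atTop
            (𝓝 (codedFun (code i).2.1 N)))
    · obtain ⟨h1, h2, j, hj⟩ := h
      exact ⟨fun m => (code i).1 m (j m), fun m => h1 _ _, fun m => h2 _ _, fun _ =>
        ⟨⟨j, fun _ => rfl⟩, hj⟩⟩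
    · refine ⟨0, fun m => tendsto_const_nhds, fun m n => ?_, fun h' => absurd h' h⟩
      simp only [Pi.zero_apply, abs_zero]
      positivity
  choose pick hp0 hp1 hp using hpick
  -- If the coded set is infinite and almost disjoint from all earlier members, a thin subset of it
  -- is added. Otherwise an initial member is repeated and the family does not grow.
  have hstep : ∀ (i : ι) (H : ι → Set (Set ℕ)), ∃ N : Set ℕ,
      (N ∈ F₀ ∧ ¬ ((code i).2.2.Infinite ∧ ∀ M ∈ F₀ ∪ H i, ((code i).2.2 ∩ M).Finite)) ∨
      ((∀ M ∈ F₀ ∪ H i, ((code i).2.2 ∩ M).Finite) ∧ N ⊆ (code i).2.2 ∧ N.Infinite ∧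
        ∀ k ≤ i, Tendsto (fun m => ∑' n, N.indicator (pick k (F₀ ∪ H k) m) n) atTop (𝓝 0)) := by
    intro i H
    by_cases h : (code i).2.2.Infinite ∧ ∀ M ∈ F₀ ∪ H i, ((code i).2.2 ∩ M).Finite
    · obtain ⟨N, hNA, hN, hb⟩ := exists_infinite_subset_forall_tendsto_tsum
        (B := (fun k => pick k (F₀ ∪ H k)) '' Set.Iic i) ((hIic i).image _)
        (by rintro _ ⟨k, -, rfl⟩ m; exact hp0 _ _ m)
        (by rintro _ ⟨k, -, rfl⟩ m n; exact hp1 _ _ m n) h.1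
      exact ⟨N, Or.inr ⟨h.2, hNA, hN, fun k hk => hb _ ⟨k, hk, rfl⟩⟩⟩
    · exact ⟨unpairClass 0, Or.inl ⟨⟨0, rfl⟩, h⟩⟩
  choose step hstep using hstep
  obtain ⟨N, hN⟩ := exists_wellFounded_recursion step
  set G : ι → Set (Set ℕ) := fun i => F₀ ∪ N '' Set.Iio i with hG
  -- Stage `i` thus reconstructs exactly the family that was present at stage `k`, hence the very
  -- solution chosen there.
  have hG' : ∀ i k, k ≤ i → F₀ ∪ N '' {l | l < i ∧ l < k} = G k := by
    intro i k hk
    have : {l | l < i ∧ l < k} = Set.Iio k := by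
      ext l
      simp only [Set.mem_ofPred_eq, Set.mem_Iio]
      exact ⟨fun h => h.2, fun h => ⟨h.trans_le hk, h⟩⟩
    rw [this]
  have key : ∀ i, (N i ∈ F₀ ∧ ¬ ((code i).2.2.Infinite ∧ ∀ M ∈ G i, ((code i).2.2 ∩ M).Finite)) ∨
      ((∀ M ∈ G i, ((code i).2.2 ∩ M).Finite) ∧ N i ⊆ (code i).2.2 ∧ (N i).Infinite ∧
        ∀ k ≤ i, Tendsto (fun m => ∑' n, (N i).indicator (pick k (G k) m) n) atTop (𝓝 0)) := by
    intro i
    have h := hstep i fun k => N '' {l | l < i ∧ l < k}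
    rw [← hN i] at h
    simp only [hG' i i le_rfl] at h
    refine h.imp id fun h => ⟨h.1, h.2.1, h.2.2.1, fun k hk => ?_⟩
    have := h.2.2.2 k hk
    rwa [hG' i k hk] at this
  set F : Set (Set ℕ) := F₀ ∪ Set.range N with hF
  have hGF : ∀ i, G i ⊆ F := fun i =>
    Set.union_subset_union_right _ (Set.image_subset_range _ _)
  have hGc : ∀ i, (G i).Countable := fun i =>
    (Set.countable_range _).union (((hIic i).mono Set.Iio_subset_Iic_self).image _)
  have hF₀inf : ∀ M ∈ F₀, M.Infinite := by
    rintro _ ⟨i, rfl⟩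
    exact unpairClass_infinite i
  have hF₀ad : ∀ M ∈ F₀, ∀ M' ∈ F₀, M ≠ M' → (M ∩ M').Finite := by
    rintro _ ⟨i, rfl⟩ _ ⟨j, rfl⟩ h
    rw [unpairClass_inter fun hij => h (congrArg _ hij)]
    exact Set.finite_empty
  have hNad : ∀ i, N i ∉ F₀ → ∀ M ∈ G i, (N i ∩ M).Finite := by
    intro i hi M hM
    rcases key i with h | h
    · exact absurd h.1 hi
    · exact (h.1 M hM).subset (Set.inter_subset_inter_left _ h.2.1)
  have hAD : IsAlmostDisjointFamily F := by
    refine ⟨?_, ?_⟩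
    · rintro M (hM | ⟨i, rfl⟩)
      · exact hF₀inf M hM
      · rcases key i with h | h
        · exact hF₀inf _ h.1
        · exact h.2.2.1
    · have aux : ∀ i, N i ∉ F₀ → ∀ M ∈ F₀, (N i ∩ M).Finite := fun i hi M hM =>
        hNad i hi M (Or.inl hM)
      intro M hM M' hM' hne
      by_cases h : M ∈ F₀ <;> by_cases h' : M' ∈ F₀
      · exact hF₀ad M h M' h' hne
      · obtain ⟨i, rfl⟩ := hM'.resolve_left h'
        rw [Set.inter_comm]
        exact aux i h' M h
      · obtain ⟨i, rfl⟩ := hM.resolve_left h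
        exact aux i h M' h'
      · obtain ⟨i, rfl⟩ := hM.resolve_left h
        obtain ⟨k, rfl⟩ := hM'.resolve_left h'
        rcases lt_trichotomy i k with hik | rfl | hik
        · rw [Set.inter_comm]
          exact hNad k h' _ (Or.inr ⟨i, hik, rfl⟩)
        · exact absurd rfl hne
        · exact hNad i h _ (Or.inr ⟨k, hik, rfl⟩)
  refine ⟨F, ⟨hAD, ?_⟩, ?_, ?_⟩
  · intro F' hF' hFF' A hA
    by_contra hAF
    have had : ∀ M ∈ F, (A ∩ M).Finite := fun M hM =>
      hF'.2 A hA M (hFF' hM) fun h => hAF (h ▸ hM)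
    obtain ⟨i, hi⟩ : (code ⁻¹' {(0, fun _ => (∅, 0), A)}).Nonempty :=
      Set.nonempty_iff_ne_empty.2 fun h => hcode _ (h ▸ Set.countable_empty)
    have hA' : (code i).2.2 = A := by rw [show code i = _ from hi]
    have := key i
    rw [hA'] at this
    rcases this with h | h
    · exact h.2 ⟨hF'.1 A hA, fun M hM => had M (hGF i hM)⟩
    · refine h.2.2.1 ((had (N i) (Or.inr ⟨i, rfl⟩)).subset (Set.subset_inter h.2.1 subset_rfl))
  · exact (Set.infinite_range_of_injective unpairClass_injective).mono Set.subset_union_left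
  · intro D hD0 hD1 τ hτ happ
    obtain ⟨p, hpF, hpτ⟩ := exists_codedFun_eq (F := F) ⟨_, Or.inl ⟨0, rfl⟩⟩ τ hτ
    have hi : ∃ i : ι, (code i).1 = D ∧ (code i).2.1 = p ∧ ∀ l, (p l).1 ∈ G i := by
      have hk : ∀ l, ∃ k : ι, (p l).1 ∈ F₀ ∨ N k = (p l).1 := by
        intro l
        rcases hpF l with h | ⟨k, hk⟩
        · obtain ⟨k, -⟩ : (code ⁻¹' {(D, p, ∅)}).Nonempty :=
            Set.nonempty_iff_ne_empty.2 fun h => hcode _ (h ▸ Set.countable_empty)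
          exact ⟨k, Or.inl h⟩
        · exact ⟨k, Or.inr hk⟩
      choose k hk using hk
      -- The stages not yet beyond the whole support form a countable set, while the task has
      -- uncountably many codes.
      have hc : (⋃ l, Set.Iic (k l)).Countable := Set.countable_iUnion fun l => hIic _
      obtain ⟨i, hi, hik⟩ := Set.not_subset.1 fun h => hcode (D, p, ∅) (hc.mono h)
      have hi' : code i = (D, p, ∅) := hi
      refine ⟨i, by rw [hi'], by rw [hi'], fun l => (hk l).imp id fun h => ⟨k l, ?_, h⟩⟩
      rw [Set.mem_iUnion, not_exists] at hik
      exact not_le.1 (hik l)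
    obtain ⟨i, rfl, rfl, hpG⟩ := hi
    obtain ⟨⟨j, hj⟩, hlim⟩ := hp i (G i) ⟨hD0, hD1, exists_selection_tendsto
      (fun m j N => ∑' n, N.indicator ((code i).1 m j) n) (codedFun (code i).2.1) (hGc i) (by
        intro m S hS ε hε
        obtain ⟨j, hj⟩ := happ m S (hS.trans (hGF i)) ε hε
        exact ⟨j, fun M hM => by rw [hpτ M (hGF i (hS hM))]; exact hj M hM⟩)⟩
    refine ⟨j, fun M hM => ?_⟩
    simp only [← hj, ← hpτ M hM]
    -- Outside `G i` the target is `0`, and the member was added at a stage `k ≥ i`, so it is thin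
    -- for the solution of task `i`.
    by_cases hMG : M ∈ G i
    · exact hlim M hMG
    · rw [codedFun_eq_zero fun l h => hMG (by rw [← h]; exact hpG l)]
      have hM₀ : M ∉ F₀ := fun h => hMG (Or.inl h)
      obtain ⟨k, rfl⟩ := hM.resolve_left hM₀
      have hik : i ≤ k := not_lt.1 fun h => hMG (Or.inr ⟨k, h, rfl⟩)
      rcases key k with h | h
      · exact absurd h.1 hM₀
      · exact h.2.2.2 i hik

/-! ### Hilbert space and Banach space tools. -/

/-- In a Hilbert space, the closures of a decreasing directed family of nonempty, uniformly bounded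
convex sets have a common point. -/
theorem exists_mem_closure_of_antitone_convex {H ι : Type*} [NormedAddCommGroup H]
    [InnerProductSpace ℝ H] [CompleteSpace H] [SemilatticeSup ι] [Nonempty ι] (E : ι → Set H)
    (hE : Antitone E) (hc : ∀ i, Convex ℝ (E i)) (hne : ∀ i, (E i).Nonempty) {R : ℝ}
    (hR : ∀ i, ∀ x ∈ E i, ‖x‖ ≤ R) : ∃ h, ∀ i, h ∈ closure (E i) := by
  set K : ι → Set H := fun i => closure (E i) with hK
  have hKanti : Antitone K := fun i j hij => closure_mono (hE hij)
  have hmin : ∀ i, ∃ x ∈ K i, ∀ y ∈ K i, ‖x‖ ≤ ‖y‖ := by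
    intro i
    obtain ⟨x, hx, h⟩ := exists_norm_eq_iInf_of_complete_convex (hne i).closure
      isClosed_closure.isComplete (hc i).closure (0 : H)
    refine ⟨x, hx, fun y hy => ?_⟩
    have hb : BddBelow (Set.range fun w : K i => ‖(0 : H) - w‖) :=
      ⟨0, by rintro _ ⟨w, rfl⟩; exact norm_nonneg _⟩
    have := ciInf_le hb ⟨y, hy⟩
    rw [← h] at this
    simpa using this
  choose x hx hxmin using hmin
  have hxR : ∀ i, ‖x i‖ ≤ R := by
    intro i
    obtain ⟨y, hy⟩ := hne i
    exact (hxmin i y (subset_closure hy)).trans (hR i y hy)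
  have hbdd : BddAbove (Set.range fun i => ‖x i‖) := ⟨R, by rintro _ ⟨i, rfl⟩; exact hxR i⟩
  set d := ⨆ i, ‖x i‖ with hd
  have hxd : ∀ i, ‖x i‖ ≤ d := fun i => le_ciSup hbdd i
  have hd0 : 0 ≤ d := (norm_nonneg _).trans (hxd (Classical.arbitrary ι))
  -- The midpoint of the minimal-norm points lies in the larger set `K i`, so its norm is at least
  -- `‖x i‖`; the parallelogram law does the rest. Since the norms approach `d`, the net `x` is
  -- Cauchy.
  have hdist : ∀ i j, i ≤ j → ‖x i - x j‖ ^ 2 ≤ 4 * (d ^ 2 - ‖x i‖ ^ 2) := by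
    intro i j hij
    have hmid : (1 / 2 : ℝ) • x i + (1 / 2 : ℝ) • x j ∈ K i :=
      (hc i).closure (hx i) (hKanti hij (hx j)) (by norm_num) (by norm_num) (by norm_num)
    have h1 := hxmin i _ hmid
    rw [← smul_add, norm_smul, Real.norm_of_nonneg (by norm_num : (0 : ℝ) ≤ 1 / 2)] at h1
    have h2 := parallelogram_law_with_norm ℝ (x i) (x j)
    have h3 := hxd j
    have h4 : 2 * ‖x i‖ ≤ ‖x i + x j‖ := by linarith
    have h5 : (2 * ‖x i‖) ^ 2 ≤ ‖x i + x j‖ ^ 2 := by gcongr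
    have h6 : ‖x j‖ ^ 2 ≤ d ^ 2 := by gcongr
    have h7 : ‖x i‖ ^ 2 ≤ d ^ 2 := by gcongr; exact hxd i
    nlinarith
  have hcauchy : Cauchy (map x atTop) := by
    rw [Metric.cauchy_iff]
    refine ⟨inferInstance, fun ε hε => ?_⟩
    have hlim : Tendsto (fun t : ℝ => 4 * (d ^ 2 - t ^ 2)) (𝓝 d) (𝓝 0) := by
      have : Continuous fun t : ℝ => 4 * (d ^ 2 - t ^ 2) := by fun_prop
      simpa using this.tendsto d
    obtain ⟨δ, hδ, hδ'⟩ := Metric.eventually_nhds_iff.1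
      (hlim.eventually (gt_mem_nhds (by positivity : (0 : ℝ) < (ε / 2) ^ 2)))
    obtain ⟨i, hi⟩ := exists_lt_of_lt_ciSup (sub_lt_self d hδ : d - δ < ⨆ i, ‖x i‖)
    have hi' := hδ' (show dist ‖x i‖ d < δ by
      rw [Real.dist_eq, abs_lt]
      constructor <;> linarith [hxd i])
    have hclose : ∀ j, i ≤ j → ‖x i - x j‖ < ε / 2 := fun j hij =>
      lt_of_pow_lt_pow_left₀ 2 (by positivity) ((hdist i j hij).trans_lt hi')
    refine ⟨x '' Set.Ici i, image_mem_map (Ici_mem_atTop i), ?_⟩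
    rintro _ ⟨j, hj, rfl⟩ _ ⟨k, hk, rfl⟩
    calc dist (x j) (x k) ≤ dist (x i) (x j) + dist (x i) (x k) := dist_triangle_left _ _ _
      _ < ε / 2 + ε / 2 := by
        rw [dist_eq_norm, dist_eq_norm]
        exact add_lt_add (hclose j hj) (hclose k hk)
      _ = ε := add_halves ε
  obtain ⟨h, hh⟩ := CompleteSpace.complete hcauchy
  refine ⟨h, fun i => isClosed_closure.mem_of_tendsto (f := x) (b := atTop) hh ?_⟩
  filter_upwards [eventually_ge_atTop i] with j hj
  exact hKanti hj (hx j)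

/-- The space `ℓ₁` is separable. -/
theorem separableSpace_lp_one : TopologicalSpace.SeparableSpace (lp (fun _ : ℕ => ℝ) 1) := by
  rw [← TopologicalSpace.isSeparable_univ_iff]
  have hs : TopologicalSpace.IsSeparable
      (Set.range fun n : ℕ => (lp.single 1 n (1 : ℝ) : lp (fun _ : ℕ => ℝ) 1)) :=
    (Set.countable_range _).isSeparable
  refine (TopologicalSpace.IsSeparable.span (R := ℝ) hs).closure.mono fun f _ => ?_
  refine mem_closure_of_tendsto (lp.hasSum_single (by norm_num) f) (Eventually.of_forall fun s => ?_)
  refine Submodule.sum_mem _ fun n _ => ?_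
  have : lp.single 1 n (f n) = f n • (lp.single 1 n (1 : ℝ) : lp (fun _ : ℕ => ℝ) 1) := by
    rw [← lp.single_smul]
    simp
  rw [this]
  exact Submodule.smul_mem _ _ (Submodule.subset_span ⟨n, rfl⟩)

/-- A bounded sequence of functionals that converges to zero on a set with dense span converges to
zero in the weak* topology. -/
theorem tendsto_zero_of_tendsto_zero_on_dense_span {X : Type*} [NormedAddCommGroup X]
    [NormedSpace ℝ X] {s : Set X} (hs : Dense (Submodule.span ℝ s : Set X))
    {u : ℕ → StrongDual ℝ X} {R : ℝ} (hR : ∀ n, ‖u n‖ ≤ R)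
    (hu : ∀ x ∈ s, Tendsto (fun n => u n x) atTop (𝓝 0)) (x : X) :
    Tendsto (fun n => u n x) atTop (𝓝 0) := by
  have hspan : ∀ y ∈ Submodule.span ℝ s, Tendsto (fun n => u n y) atTop (𝓝 0) := by
    intro y hy
    induction hy using Submodule.span_induction with
    | mem y hy => exact hu y hy
    | zero => simp
    | add y z _ _ hy hz => simpa using hy.add hz
    | smul c y _ hy => simpa using hy.const_mul c
  have hR0 : 0 ≤ R := (norm_nonneg _).trans (hR 0)
  rw [Metric.tendsto_atTop]
  intro ε hε
  obtain ⟨y, hy, hxy⟩ := Metric.mem_closure_iff.1 (hs x) (ε / 2 / (R + 1)) (by positivity)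
  obtain ⟨n₀, hn₀⟩ := Metric.tendsto_atTop.1 (hspan y hy) (ε / 2) (half_pos hε)
  refine ⟨n₀, fun n hn => ?_⟩
  have h1 := hn₀ n hn
  rw [dist_zero_right] at h1 ⊢
  have h2 : ‖u n (x - y)‖ ≤ ε / 2 := by
    rw [dist_eq_norm, lt_div_iff₀ (by positivity)] at hxy
    calc ‖u n (x - y)‖ ≤ ‖u n‖ * ‖x - y‖ := (u n).le_opNorm _
      _ ≤ (R + 1) * ‖x - y‖ := by gcongr; linarith [hR n]
      _ ≤ ε / 2 := by linarith
  calc ‖u n x‖ = ‖u n (x - y) + u n y‖ := by rw [← map_add, sub_add_cancel]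
    _ ≤ ‖u n (x - y)‖ + ‖u n y‖ := norm_add_le _ _
    _ < ε := by linarith

/-! ### Coordinates of functionals on the uncompleted space. -/

namespace JohnsonLindenstrauss

noncomputable section

variable {F : Set (Set ℕ)} (hF : IsAlmostDisjointFamily F)

theorem chi_singleton_mem_c0 (n : ℕ) : chi {n} ∈ c0 := by
  refine tendsto_const_nhds.congr' ?_
  filter_upwards [eventually_gt_atTop n] with m hm
  rw [chi_apply, Set.indicator_of_notMem]
  simpa using hm.ne'

/-- The unit vector `e_n`, as an element of `span (c₀ ∪ {χ_N : N ∈ F})`. -/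
def JLPre.unit (n : ℕ) : JLPre F hF := (JLPre.repr hF).symm (⟨chi {n}, chi_singleton_mem_c0 n⟩, 0)

/-- The characteristic function of a member of `F`, as an element of
`span (c₀ ∪ {χ_N : N ∈ F})`. -/
def JLPre.ind (N : F) : JLPre F hF := (JLPre.repr hF).symm (0, Finsupp.single N 1)

theorem JLPre.coeff_repr_symm (x : c0) (a : F →₀ ℝ) :
    JLPre.coeff hF ((JLPre.repr hF).symm (x, a)) = a := by
  simp [JLPre.coeff]

theorem JLPre.incl_repr_symm (x : c0) (a : F →₀ ℝ) :
    JLPre.incl hF ((JLPre.repr hF).symm (x, a)) =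
      (x : EllInfty) + a.sum (fun N t => t • chi (N : Set ℕ)) := by
  rw [← JLPre.jlMap_repr, LinearEquiv.apply_symm_apply, jlMap_apply]

@[simp] theorem JLPre.coeff_unit (n : ℕ) : JLPre.coeff hF (JLPre.unit hF n) = 0 :=
  JLPre.coeff_repr_symm hF _ _

@[simp] theorem JLPre.coeff_ind (N : F) : JLPre.coeff hF (JLPre.ind hF N) = Finsupp.single N 1 :=
  JLPre.coeff_repr_symm hF _ _

@[simp] theorem JLPre.incl_unit (n : ℕ) : JLPre.incl hF (JLPre.unit hF n) = chi {n} := by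
  simp [JLPre.unit, JLPre.incl_repr_symm]

@[simp] theorem JLPre.incl_ind (N : F) : JLPre.incl hF (JLPre.ind hF N) = chi N := by
  simp [JLPre.ind, JLPre.incl_repr_symm]

theorem JLPre.norm_le {y : JLPre F hF} {R : ℝ} (hR : 0 ≤ R)
    (h : ∀ n, |JLPre.incl hF y n| ≤ R) (h' : l2norm (JLPre.coeff hF y) ≤ R) : ‖y‖ ≤ R :=
  max_le (lp.norm_le_of_forall_le hR h) h'

theorem chi_singleton_apply (n m : ℕ) : chi {n} m = if n = m then 1 else 0 := by
  rw [chi_apply, Set.indicator_apply]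
  simp [eq_comm]

theorem incl_sum_unit_apply (S : Finset ℕ) (s : ℕ → ℝ) (m : ℕ) :
    JLPre.incl hF (∑ n ∈ S, s n • JLPre.unit hF n) m = if m ∈ S then s m else 0 := by
  rw [map_sum, lp.coeFn_sum, Finset.sum_apply]
  simp only [map_smul, JLPre.incl_unit, lp.coeFn_smul, Pi.smul_apply, chi_singleton_apply,
    smul_eq_mul, mul_ite, mul_one, mul_zero]
  exact Finset.sum_ite_eq' S m s

/-- Test `ψ` on the combination of unit vectors with the signs of its values: its sup norm is at
most `1` and it has no `ℓ₂` part. -/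
theorem sum_abs_unit_le (ψ : StrongDual ℝ (JLPre F hF)) (S : Finset ℕ) :
    ∑ n ∈ S, |ψ (JLPre.unit hF n)| ≤ ‖ψ‖ := by
  set w : JLPre F hF := ∑ n ∈ S, (SignType.sign (ψ (JLPre.unit hF n)) : ℝ) • JLPre.unit hF n
    with hw
  have hw1 : ‖w‖ ≤ 1 := by
    refine JLPre.norm_le hF zero_le_one (fun m => ?_) ?_
    · rw [hw, incl_sum_unit_apply]
      split_ifs
      · rcases SignType.sign (ψ (JLPre.unit hF m)) with _ | _ | _ <;> simp
      · simp
    · simp [hw, l2norm]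
  calc ∑ n ∈ S, |ψ (JLPre.unit hF n)| = ψ w := by
        simp [hw, sign_mul_self]
    _ ≤ ‖ψ‖ * ‖w‖ := (le_abs_self _).trans (ψ.le_opNorm w)
    _ ≤ ‖ψ‖ := mul_le_of_le_one_right (norm_nonneg _) hw1

theorem summable_unit (ψ : StrongDual ℝ (JLPre F hF)) : Summable fun n => ψ (JLPre.unit hF n) :=
  (summable_of_sum_le (fun _ => abs_nonneg _) (sum_abs_unit_le hF ψ)).of_abs

/-- The coordinates of a functional at the unit vectors, as a linear map to `ℓ₁`. -/
def dualUnit : StrongDual ℝ (JLPre F hF) →ₗ[ℝ] lp (fun _ : ℕ => ℝ) 1 where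
  toFun ψ := ⟨fun n => ψ (JLPre.unit hF n), memℓp_gen (by simpa using (summable_unit hF ψ).abs)⟩
  map_add' _ _ := rfl
  map_smul' _ _ := rfl

/-- The difference between the value of a functional at `χ_N` and the sum over `N` of its values at
the unit vectors. -/
def residual (N : F) : StrongDual ℝ (JLPre F hF) →ₗ[ℝ] ℝ where
  toFun ψ := ψ (JLPre.ind hF N) - ∑' n, (N : Set ℕ).indicator (fun n => ψ (JLPre.unit hF n)) n
  map_add' ψ θ := by
    have : (N : Set ℕ).indicator (fun n => (ψ + θ) (JLPre.unit hF n)) = fun n =>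
        (N : Set ℕ).indicator (fun n => ψ (JLPre.unit hF n)) n +
          (N : Set ℕ).indicator (fun n => θ (JLPre.unit hF n)) n := by
      ext n
      by_cases h : n ∈ (N : Set ℕ) <;> simp [h]
    rw [this, ((summable_unit hF ψ).indicator _).tsum_add ((summable_unit hF θ).indicator _)]
    simp only [add_apply]
    ring
  map_smul' c ψ := by
    have : (N : Set ℕ).indicator (fun n => (c • ψ) (JLPre.unit hF n)) = fun n =>
        c * (N : Set ℕ).indicator (fun n => ψ (JLPre.unit hF n)) n := by
      ext n
      by_cases h : n ∈ (N : Set ℕ) <;> simp [h]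
    rw [this, tsum_mul_left]
    simp only [smul_apply, smul_eq_mul, RingHom.id_apply]
    ring

theorem residual_apply (N : F) (ψ : StrongDual ℝ (JLPre F hF)) :
    residual hF N ψ =
      ψ (JLPre.ind hF N) - ∑' n, (N : Set ℕ).indicator (fun n => ψ (JLPre.unit hF n)) n := rfl

/-- The finite combination of unit vectors and of characteristic functions of members of `F`
cut off below `k`. -/
def cutoffComb (k : ℕ) (A : Finset ℕ) (s : ℕ → ℝ) (B : Finset F) (t : F → ℝ) : JLPre F hF :=
  ∑ n ∈ A, s n • JLPre.unit hF n + ∑ N ∈ B, t N • (JLPre.ind hF N -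
    ∑ n ∈ Finset.range k, (N : Set ℕ).indicator (fun _ => (1 : ℝ)) n • JLPre.unit hF n)

theorem coeff_cutoffComb (k : ℕ) (A : Finset ℕ) (s : ℕ → ℝ) (B : Finset F) (t : F → ℝ) :
    JLPre.coeff hF (cutoffComb hF k A s B t) = ∑ N ∈ B, Finsupp.single N (t N) := by
  simp [cutoffComb]

theorem incl_cutoffComb (k : ℕ) (A : Finset ℕ) (s : ℕ → ℝ) (B : Finset F) (t : F → ℝ) (m : ℕ) :
    JLPre.incl hF (cutoffComb hF k A s B t) m = (if m ∈ A then s m else 0) +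
      if m < k then 0 else ∑ N ∈ B, t N * (N : Set ℕ).indicator (fun _ => (1 : ℝ)) m := by
  rw [cutoffComb, map_add, lp.coeFn_add, Pi.add_apply, incl_sum_unit_apply, map_sum,
    lp.coeFn_sum, Finset.sum_apply]
  congr 1
  have : ∀ N : F, JLPre.incl hF (t N • (JLPre.ind hF N - ∑ n ∈ Finset.range k,
      (N : Set ℕ).indicator (fun _ => (1 : ℝ)) n • JLPre.unit hF n)) m =
      if m < k then 0 else t N * (N : Set ℕ).indicator (fun _ => (1 : ℝ)) m := by
    intro N
    rw [map_smul, lp.coeFn_smul, Pi.smul_apply, map_sub, lp.coeFn_sub, Pi.sub_apply,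
      incl_sum_unit_apply, JLPre.incl_ind, chi_apply]
    simp only [Finset.mem_range, smul_eq_mul]
    split_ifs <;> simp
  simp only [this]
  split_ifs <;> simp

theorem exists_cutoff {F : Set (Set ℕ)} (hF : IsAlmostDisjointFamily F) (B : Finset F) : ∃ k₀ : ℕ, ∀ m ≥ k₀, ∀ N ∈ B, ∀ M ∈ B,
    m ∈ (N : Set ℕ) → m ∈ (M : Set ℕ) → N = M := by
  have h : ∀ᶠ m in atTop, ∀ N ∈ B, ∀ M ∈ B, m ∈ (N : Set ℕ) → m ∈ (M : Set ℕ) → N = M := by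
    rw [Filter.eventually_all_finset]
    intro N _
    rw [Filter.eventually_all_finset]
    intro M _
    by_cases hNM : N = M
    · exact Eventually.of_forall fun _ _ _ => hNM
    · have := (hF.2 N N.2 M M.2 fun h => hNM (Subtype.ext h)).compl_mem_cofinite
      rw [Nat.cofinite_eq_atTop] at this
      filter_upwards [this] with m hm h1 h2
      exact absurd ⟨h1, h2⟩ hm
  exact eventually_atTop.1 h

/-- For large `k` the cut-off sets are pairwise disjoint and miss `A`, so each coordinate involves
at most one `s n` or `t N`. The sup norm is then bounded by the largest coefficient, and the `ℓ₂`
part sees only the `t N`. -/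
theorem norm_cutoffComb_le (A : Finset ℕ) (s : ℕ → ℝ) (B : Finset F) (t : F → ℝ) :
    ∀ᶠ k in atTop, ‖cutoffComb hF k A s B t‖ ≤ √(∑ n ∈ A, s n ^ 2 + ∑ N ∈ B, t N ^ 2) := by
  classical
  obtain ⟨k₀, hk₀⟩ := exists_cutoff hF B
  have hsA : ∀ n ∈ A, |s n| ≤ √(∑ n ∈ A, s n ^ 2 + ∑ N ∈ B, t N ^ 2) := fun n hn => by
    rw [← Real.sqrt_sq_eq_abs]
    refine Real.sqrt_le_sqrt ((Finset.single_le_sum (f := fun n => s n ^ 2)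
      (fun _ _ => sq_nonneg _) hn).trans (le_add_of_nonneg_right ?_))
    exact Finset.sum_nonneg fun _ _ => sq_nonneg _
  have htB : ∀ N ∈ B, |t N| ≤ √(∑ n ∈ A, s n ^ 2 + ∑ N ∈ B, t N ^ 2) := fun N hN => by
    rw [← Real.sqrt_sq_eq_abs]
    refine Real.sqrt_le_sqrt ((Finset.single_le_sum (f := fun N => t N ^ 2)
      (fun _ _ => sq_nonneg _) hN).trans (le_add_of_nonneg_left ?_))
    exact Finset.sum_nonneg fun _ _ => sq_nonneg _
  filter_upwards [eventually_ge_atTop k₀, eventually_gt_atTop (A.sup id)] with k hk hkA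
  refine JLPre.norm_le hF (Real.sqrt_nonneg _) (fun m => ?_) ?_
  · rw [incl_cutoffComb]
    by_cases hm : m < k
    · rw [if_pos hm, add_zero]
      split_ifs with h
      · exact hsA m h
      · simp
    · have hmA : m ∉ A := fun h => hm ((Finset.le_sup (f := id) h).trans_lt hkA)
      rw [if_neg hm, if_neg hmA, zero_add]
      by_cases h : ∃ N ∈ B, m ∈ (N : Set ℕ)
      · obtain ⟨N, hN, hmN⟩ := h
        rw [Finset.sum_eq_single_of_mem N hN]
        · simpa [hmN] using htB N hN
        · intro M hM hMN
          rw [Set.indicator_of_notMem, mul_zero]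
          exact fun hmM => hMN (hk₀ m (by omega) M hM N hN hmM hmN)
      · push Not at h
        rw [Finset.sum_eq_zero]
        · simp
        · intro N hN
          simp [h N hN]
  · rw [coeff_cutoffComb, l2norm]
    have hval : ∀ N, (∑ M ∈ B, Finsupp.single M (t M)) N = if N ∈ B then t N else 0 := by
      intro N
      simp [Finsupp.finsetSum_apply, Finsupp.single_apply]
    refine Real.sqrt_le_sqrt ?_
    rw [Finsupp.sum_of_support_subset _ (s := B) _ _ (by simp)]
    · rw [Finset.sum_congr rfl fun N hN => by rw [hval N, if_pos hN]]
      exact le_add_of_nonneg_left (Finset.sum_nonneg fun _ _ => sq_nonneg _)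
    · intro N hN
      by_contra h
      rw [Finsupp.mem_support_iff, hval, if_neg h] at hN
      exact hN rfl

/-- Cutting off below `k` subtracts the partial sums of `∑_{n ∈ N} ψ(e_n)`, so the residual appears
in the limit. -/
theorem tendsto_apply_cutoffComb (ψ : StrongDual ℝ (JLPre F hF)) (A : Finset ℕ) (s : ℕ → ℝ)
    (B : Finset F) (t : F → ℝ) : Tendsto (fun k => ψ (cutoffComb hF k A s B t)) atTop
      (𝓝 (∑ n ∈ A, s n * ψ (JLPre.unit hF n) + ∑ N ∈ B, t N * residual hF N ψ)) := by
  simp only [cutoffComb, map_add, map_sum, map_smul, map_sub, smul_eq_mul]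
  refine tendsto_const_nhds.add (tendsto_finsetSum _ fun N _ => Tendsto.const_mul _ ?_)
  rw [residual_apply]
  refine tendsto_const_nhds.sub ?_
  have := ((summable_unit hF ψ).indicator (N : Set ℕ)).hasSum.tendsto_sum_nat
  refine this.congr fun k => Finset.sum_congr rfl fun n _ => ?_
  by_cases h : n ∈ (N : Set ℕ) <;> simp [h]

/-- Self-duality of `ℓ₂`: testing `ψ` on cut-off combinations whose coefficients are its own
coordinates gives `Q ≤ ‖ψ‖ * √Q`. -/
theorem sum_sq_le (ψ : StrongDual ℝ (JLPre F hF)) (A : Finset ℕ) (B : Finset F) :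
    ∑ n ∈ A, ψ (JLPre.unit hF n) ^ 2 + ∑ N ∈ B, residual hF N ψ ^ 2 ≤ ‖ψ‖ ^ 2 := by
  set Q := ∑ n ∈ A, ψ (JLPre.unit hF n) ^ 2 + ∑ N ∈ B, residual hF N ψ ^ 2 with hQ
  have hQ0 : 0 ≤ Q := add_nonneg (Finset.sum_nonneg fun _ _ => sq_nonneg _)
    (Finset.sum_nonneg fun _ _ => sq_nonneg _)
  have h : Q ≤ ‖ψ‖ * √Q := by
    have hlim := tendsto_apply_cutoffComb hF ψ A (fun n => ψ (JLPre.unit hF n)) B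
      (fun N => residual hF N ψ)
    simp only [← sq] at hlim
    refine le_of_tendsto hlim ?_
    filter_upwards [norm_cutoffComb_le hF A (fun n => ψ (JLPre.unit hF n)) B
      (fun N => residual hF N ψ)] with k hk
    exact ((le_abs_self _).trans (ψ.le_opNorm _)).trans
      (mul_le_mul_of_nonneg_left hk (norm_nonneg _))
  have h2 : √Q ≤ ‖ψ‖ := by
    rcases (Real.sqrt_nonneg Q).eq_or_lt with h0 | h0
    · rw [← h0]
      exact norm_nonneg _
    · refine le_of_mul_le_mul_right ?_ h0
      rwa [Real.mul_self_sqrt hQ0]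
  calc Q = √Q ^ 2 := (Real.sq_sqrt hQ0).symm
    _ ≤ ‖ψ‖ ^ 2 := by gcongr

theorem sum_dualCoord_le (ψ : StrongDual ℝ (JLPre F hF)) (S : Finset (ℕ ⊕ F)) :
    ∑ i ∈ S, ‖Sum.elim (fun n => ψ (JLPre.unit hF n)) (fun N => residual hF N ψ) i‖ ^
      (2 : ℝ≥0∞).toReal ≤ ‖ψ‖ ^ (2 : ℝ≥0∞).toReal := by
  have h := sum_sq_le hF ψ S.toLeft S.toRight
  rw [← Finset.toLeft_disjSum_toRight (u := S), Finset.sum_disjSum]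
  simpa using h

/-- The values at the unit vectors and the residuals of a functional, as a linear map to `ℓ₂`. -/
def dualCoord : StrongDual ℝ (JLPre F hF) →ₗ[ℝ] lp (fun _ : ℕ ⊕ F => ℝ) 2 where
  toFun ψ := ⟨Sum.elim (fun n => ψ (JLPre.unit hF n)) (fun N => residual hF N ψ),
    memℓp_gen' (sum_dualCoord_le hF ψ)⟩
  map_add' ψ θ := by
    ext (n | N)
    · rfl
    · exact map_add (residual hF N) ψ θ
  map_smul' c ψ := by
    ext (n | N)
    · rfl
    · exact map_smul (residual hF N) c ψ

theorem dualCoord_inr (ψ : StrongDual ℝ (JLPre F hF)) (N : F) :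
    dualCoord hF ψ (Sum.inr N) = residual hF N ψ := rfl

theorem norm_dualCoord_le (ψ : StrongDual ℝ (JLPre F hF)) : ‖dualCoord hF ψ‖ ≤ ‖ψ‖ :=
  lp.norm_le_of_forall_sum_le (by simp) (norm_nonneg _) (sum_dualCoord_le hF ψ)

/-- Only the `c₀` part needs approximation; its tails are small in sup norm and contribute nothing
to the `ℓ₂` part. -/
theorem dense_span_unit_ind :
    Dense (Submodule.span ℝ (Set.range (JLPre.unit hF) ∪ Set.range (JLPre.ind hF)) :
      Set (JLPre F hF)) := by
  set V := Submodule.span ℝ (Set.range (JLPre.unit hF) ∪ Set.range (JLPre.ind hF)) with hV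
  have hunit : ∀ n, JLPre.unit hF n ∈ V := fun n => Submodule.subset_span (Or.inl ⟨n, rfl⟩)
  have hind : ∀ N, JLPre.ind hF N ∈ V := fun N => Submodule.subset_span (Or.inr ⟨N, rfl⟩)
  intro y
  obtain ⟨⟨x, a⟩, rfl⟩ := (JLPre.repr hF).symm.surjective y
  rw [Metric.mem_closure_iff]
  intro ε hε
  have hx : Tendsto (fun n => (x : EllInfty) n) atTop (𝓝 0) := x.2
  obtain ⟨k, hk⟩ := Metric.tendsto_atTop.1 hx (ε / 2) (half_pos hε)
  set z : JLPre F hF := ∑ n ∈ Finset.range k, (x : EllInfty) n • JLPre.unit hF n with hz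
  set w : JLPre F hF := (JLPre.repr hF).symm (0, a) with hw
  have hwV : w ∈ V := by
    have : w = a.sum fun N t => t • JLPre.ind hF N := by
      rw [hw, LinearEquiv.symm_apply_eq, Finsupp.sum, map_sum]
      simp only [map_smul, JLPre.ind, LinearEquiv.apply_symm_apply, Prod.smul_mk, smul_zero,
        Finsupp.smul_single, smul_eq_mul, mul_one]
      refine Prod.ext ?_ ?_
      · simp [Prod.fst_sum]
      · rw [Prod.snd_sum]
        exact (Finsupp.sum_single a).symm
    rw [this]
    exact Submodule.sum_mem _ fun N _ => Submodule.smul_mem _ _ (hind N)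
  have hzV : z ∈ V := Submodule.sum_mem _ fun n _ => Submodule.smul_mem _ _ (hunit n)
  refine ⟨z + w, Submodule.add_mem _ hzV hwV, ?_⟩
  have hsplit : (JLPre.repr hF).symm (x, a) = (JLPre.repr hF).symm (x, 0) + w := by
    rw [hw, ← map_add]
    simp
  rw [dist_eq_norm, hsplit, add_sub_add_right_eq_sub]
  refine lt_of_le_of_lt (JLPre.norm_le hF (half_pos hε).le (fun m => ?_) ?_) (half_lt_self hε)
  · rw [map_sub, lp.coeFn_sub, Pi.sub_apply, hz, incl_sum_unit_apply, JLPre.incl_repr_symm]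
    simp only [Finsupp.sum_zero_index, add_zero, Finset.mem_range]
    split_ifs with h
    · simpa using (half_pos hε).le
    · have := hk m (not_lt.1 h)
      rw [dist_zero_right] at this
      simpa using this.le
  · rw [map_sub, JLPre.coeff_repr_symm, hz]
    simpa [l2norm] using (half_pos hε).le

end

end JohnsonLindenstrauss

/-! ### Weak* approximation and Efremov's property. -/

/-- The image of a nonempty set in a separable metric space is approximated by the image of a
sequence in that set. -/
theorem exists_seq_dense_image {α Y : Type*} [PseudoMetricSpace Y]
    [TopologicalSpace.SeparableSpace Y] (A : α → Y) {W : Set α} (hW : W.Nonempty) :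
    ∃ d : ℕ → α, (∀ j, d j ∈ W) ∧ ∀ a ∈ W, ∀ ε > 0, ∃ j, dist (A a) (A (d j)) < ε := by
  have : SecondCountableTopology Y := UniformSpace.secondCountable_of_separable Y
  have : Nonempty (A '' W) := (hW.image A).to_subtype
  have hmem : ∀ j, ∃ a ∈ W, A a = TopologicalSpace.denseSeq (A '' W) j := fun j =>
    (TopologicalSpace.denseSeq (A '' W) j).2
  choose d hdW hd using hmem
  refine ⟨d, hdW, fun a ha ε hε => ?_⟩
  obtain ⟨j, hj⟩ := (TopologicalSpace.denseRange_denseSeq (A '' W)).exists_dist_lt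
    ⟨A a, a, ha, rfl⟩ hε
  exact ⟨j, by rw [hd j]; exact hj⟩

/-- Points of the weak* closure are approximated on finite sets. -/
theorem exists_mem_forall_abs_sub_lt {X : Type*} [NormedAddCommGroup X] [NormedSpace ℝ X]
    {C : Set (StrongDual ℝ X)} {f : StrongDual ℝ X}
    (hf : StrongDual.toWeakDual f ∈ closure (StrongDual.toWeakDual '' C : Set (WeakDual ℝ X)))
    (S : Finset X) {ε : ℝ} (hε : 0 < ε) : ∃ φ ∈ C, ∀ x ∈ S, |φ x - f x| < ε := by
  have hopen : ∀ᶠ g : WeakDual ℝ X in 𝓝 (StrongDual.toWeakDual f), ∀ x ∈ S, |g x - f x| < ε := by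
    rw [Filter.eventually_all_finset]
    intro x _
    have hc : Continuous fun g : WeakDual ℝ X => |g x - f x| :=
      ((WeakDual.eval_continuous x).sub continuous_const).abs
    have h0 : |(StrongDual.toWeakDual f : WeakDual ℝ X) x - f x| < ε := by
      simpa using hε
    exact hc.continuousAt.eventually (gt_mem_nhds h0)
  obtain ⟨_, h, φ, hφ, rfl⟩ := mem_closure_iff_nhds.1 hf _ hopen
  exact ⟨φ, hφ, h⟩

namespace JohnsonLindenstrauss

/-- The functionals on a Johnson-Lindenstrauss space, restricted to the uncompleted space. -/
noncomputable def JL2.restrict {F : Set (Set ℕ)} (hF : IsAlmostDisjointFamily F) :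
    StrongDual ℝ (JL2 F hF) →ₗ[ℝ] StrongDual ℝ (JLPre F hF) where
  toFun φ := φ.comp UniformSpace.Completion.toComplL
  map_add' _ _ := rfl
  map_smul' _ _ := rfl

theorem JL2.restrict_apply {F : Set (Set ℕ)} (hF : IsAlmostDisjointFamily F)
    (φ : StrongDual ℝ (JL2 F hF)) (y : JLPre F hF) :
    JL2.restrict hF φ y = φ (y : JL2 F hF) := rfl

theorem JL2.norm_restrict_le {F : Set (Set ℕ)} (hF : IsAlmostDisjointFamily F)
    (φ : StrongDual ℝ (JL2 F hF)) : ‖JL2.restrict hF φ‖ ≤ ‖φ‖ :=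
  ContinuousLinearMap.opNorm_le_bound _ (norm_nonneg _) fun y => by
    rw [JL2.restrict_apply, ← UniformSpace.Completion.norm_coe y]
    exact φ.le_opNorm _

/-- A bounded sequence of functionals that tends to zero at the unit vectors and at the
characteristic functions of the members of `F` is weak*-null. -/
theorem JL2.tendsto_zero {F : Set (Set ℕ)} (hF : IsAlmostDisjointFamily F)
    {u : ℕ → StrongDual ℝ (JL2 F hF)} {R : ℝ} (hR : ∀ m, ‖u m‖ ≤ R)
    (hunit : ∀ n, Tendsto (fun m => JL2.restrict hF (u m) (JLPre.unit hF n)) atTop (𝓝 0))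
    (hind : ∀ N, Tendsto (fun m => JL2.restrict hF (u m) (JLPre.ind hF N)) atTop (𝓝 0))
    (x : JL2 F hF) : Tendsto (fun m => u m x) atTop (𝓝 0) := by
  refine tendsto_zero_of_tendsto_zero_on_dense_span
    (s := (UniformSpace.Completion.toComplL : JLPre F hF →L[ℝ] JL2 F hF) ''
      (Set.range (JLPre.unit hF) ∪ Set.range (JLPre.ind hF))) ?_ hR ?_ x
  · have h := UniformSpace.Completion.denseRange_coe.dense_image
      (UniformSpace.Completion.continuous_coe _) (dense_span_unit_ind hF)
    have hmap := Submodule.map_span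
      (UniformSpace.Completion.toComplL : JLPre F hF →L[ℝ] JL2 F hF).toLinearMap
      (Set.range (JLPre.unit hF) ∪ Set.range (JLPre.ind hF))
    have hcoe := congrArg (fun V : Submodule ℝ (JL2 F hF) => (V : Set (JL2 F hF))) hmap
    simp only [Submodule.map_coe] at hcoe
    exact hcoe ▸ h
  · rintro _ ⟨_, ⟨n, rfl⟩ | ⟨N, rfl⟩, rfl⟩
    · exact hunit n
    · exact hind N

/-- If a family of bounded convex sets of functionals accumulates weak* at zero, then it
accumulates simultaneously in `ℓ₂`-norm of the coordinates at some point. -/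
theorem exists_dualCoord_limit {F : Set (Set ℕ)} (hF : IsAlmostDisjointFamily F)
    {C : Set (StrongDual ℝ (JL2 F hF))} (hC : Convex ℝ C) {R : ℝ} (hR : ∀ ψ ∈ C, ‖ψ‖ ≤ R)
    (h0 : ∀ S : Finset (JL2 F hF), ∀ ε > 0, ∃ ψ ∈ C, ∀ x ∈ S, |ψ x| < ε) :
    ∃ h : lp (fun _ : ℕ ⊕ F => ℝ) 2, (∀ n, h (Sum.inl n) = 0) ∧
      ∀ S : Finset (JL2 F hF), ∀ ε > 0, ∃ ψ ∈ C, (∀ x ∈ S, |ψ x| < ε) ∧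
        ‖dualCoord hF (JL2.restrict hF ψ) - h‖ < ε := by
  classical
  set T := (dualCoord hF).comp (JL2.restrict hF) with hT
  set V : Finset (JL2 F hF) × ℕ → Set (StrongDual ℝ (JL2 F hF)) := fun p =>
    {ψ | ψ ∈ C ∧ ∀ x ∈ p.1, |ψ x| < 1 / ((p.2 : ℝ) + 1)} with hV
  have hVanti : Antitone V := by
    intro p q hpq ψ hψ
    refine ⟨hψ.1, fun x hx => (hψ.2 x (hpq.1 hx)).trans_le ?_⟩
    have : (p.2 : ℝ) ≤ q.2 := by exact_mod_cast hpq.2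
    gcongr
  have hVconv : ∀ p, Convex ℝ (V p) := by
    rintro p ψ hψ θ hθ a b ha hb hab
    refine ⟨hC hψ.1 hθ.1 ha hb hab, fun x hx => ?_⟩
    have := (convex_ball (0 : ℝ) (1 / ((p.2 : ℝ) + 1))) (x := ψ x) (by simpa using hψ.2 x hx)
      (y := θ x) (by simpa using hθ.2 x hx) ha hb hab
    simpa using this
  obtain ⟨h, hh⟩ := exists_mem_closure_of_antitone_convex (fun p => T '' V p)
    (fun p q hpq => Set.image_mono (hVanti hpq)) (fun p => (hVconv p).linear_image T)
    (fun p => by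
      obtain ⟨ψ, hψ, hψ'⟩ := h0 p.1 (1 / ((p.2 : ℝ) + 1)) (by positivity)
      exact ⟨T ψ, ψ, ⟨hψ, hψ'⟩, rfl⟩) (R := R) (by
      rintro p _ ⟨ψ, hψ, rfl⟩
      exact ((norm_dualCoord_le hF _).trans (JL2.norm_restrict_le hF ψ)).trans (hR ψ hψ.1))
  have happ : ∀ S : Finset (JL2 F hF), ∀ ε > 0, ∃ ψ ∈ C, (∀ x ∈ S, |ψ x| < ε) ∧
      ‖T ψ - h‖ < ε := by
    intro S ε hε
    obtain ⟨k, hk⟩ := exists_nat_one_div_lt hε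
    obtain ⟨_, ⟨ψ, hψ, rfl⟩, hd⟩ := Metric.mem_closure_iff.1 (hh (S, k)) ε hε
    refine ⟨ψ, hψ.1, fun x hx => (hψ.2 x hx).trans hk, ?_⟩
    rwa [← dist_eq_norm, dist_comm]
  refine ⟨h, fun n => ?_, happ⟩
  by_contra hn
  -- With this `ε`, `ψ(e_n)` would be closer than `|h_n| / 2` both to `0` and to `h_n`.
  obtain ⟨ψ, -, h1, h2⟩ := happ {((JLPre.unit hF n : JLPre F hF) : JL2 F hF)}
    (|h (Sum.inl n)| / 2) (by positivity)
  have h3 := h1 _ (Finset.mem_singleton_self _)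
  have h4 : |ψ ((JLPre.unit hF n : JLPre F hF) : JL2 F hF) - h (Sum.inl n)| ≤ ‖T ψ - h‖ :=
    lp.norm_apply_le_norm (by norm_num) (T ψ - h) (Sum.inl n)
  have h5 := abs_sub_abs_le_abs_sub (h (Sum.inl n)) (ψ (JLPre.unit hF n : JLPre F hF))
  rw [abs_sub_comm] at h5
  linarith

/-- Summation over `N` is 1-Lipschitz on `ℓ₁`, uniformly in `N`, so a sequence dense in the `ℓ₁`
distance serves all members of the family at once. -/
theorem abs_tsum_indicator_sub_le {F : Set (Set ℕ)} (hF : IsAlmostDisjointFamily F)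
    (ψ θ : StrongDual ℝ (JLPre F hF)) (N : Set ℕ) :
    |∑' n, N.indicator (fun n => ψ (JLPre.unit hF n)) n -
      ∑' n, N.indicator (fun n => θ (JLPre.unit hF n)) n| ≤ ‖dualUnit hF ψ - dualUnit hF θ‖ := by
  have hs := (summable_unit hF ψ).sub (summable_unit hF θ)
  rw [← ((summable_unit hF ψ).indicator N).tsum_sub ((summable_unit hF θ).indicator N),
    lp.norm_eq_tsum_rpow (by norm_num)]
  simp only [ENNReal.toReal_one, Real.rpow_one, div_one]
  refine (norm_tsum_le_tsum_norm (f := fun n => N.indicator (fun n => ψ (JLPre.unit hF n)) n -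
    N.indicator (fun n => θ (JLPre.unit hF n)) n) ?_).trans ?_
  all_goals
    have he : ∀ n, N.indicator (fun n => ψ (JLPre.unit hF n)) n -
        N.indicator (fun n => θ (JLPre.unit hF n)) n =
        N.indicator (fun n => ψ (JLPre.unit hF n) - θ (JLPre.unit hF n)) n := fun n => by
      by_cases h : n ∈ N <;> simp [h]
    simp only [he]
  · exact (hs.indicator N).norm
  · exact (hs.indicator N).norm.tsum_le_tsum (fun n => norm_indicator_le_norm_self _ _) hs.norm

/-- The Johnson-Lindenstrauss space of an almost disjoint family with the selection property of
`exists_isMADFamily_selection` has Efremov's property. -/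
theorem hasEfremovProperty_of_selection {F : Set (Set ℕ)} (hF : IsAlmostDisjointFamily F)
    (hsel : ∀ D : ℕ → ℕ → ℕ → ℝ, (∀ m j, Tendsto (D m j) atTop (𝓝 0)) →
      (∀ m j n, |D m j n| ≤ 1 / ((m : ℝ) + 1)) →
      ∀ τ : Set ℕ → ℝ, (F ∩ {N | τ N ≠ 0}).Countable →
      (∀ m, ∀ S : Finset (Set ℕ), (S : Set (Set ℕ)) ⊆ F → ∀ ε > 0,
        ∃ j, ∀ N ∈ S, |∑' n, N.indicator (D m j) n - τ N| < ε) →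
      ∃ j : ℕ → ℕ, ∀ N ∈ F,
        Tendsto (fun m => ∑' n, N.indicator (D m (j m)) n) atTop (𝓝 (τ N))) :
    HasEfremovProperty (JL2 F hF) := by
  classical
  intro C₀ hC₀ hbdd f hf
  set C : Set (StrongDual ℝ (JL2 F hF)) := (fun φ => φ + -f) '' C₀ with hCdef
  have hC : Convex ℝ C := by
    have := hC₀.translate (-f)
    simpa [hCdef, add_comm] using this
  obtain ⟨R₀, hR₀⟩ := hbdd.exists_norm_le
  have hR : ∀ ψ ∈ C, ‖ψ‖ ≤ R₀ + ‖f‖ := by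
    rintro _ ⟨φ, hφ, rfl⟩
    refine (norm_add_le _ _).trans ?_
    rw [norm_neg]
    gcongr
    exact hR₀ φ hφ
  obtain ⟨h, hinl, happ⟩ := exists_dualCoord_limit hF hC hR (by
    intro S ε hε
    obtain ⟨φ, hφ, hφ'⟩ := exists_mem_forall_abs_sub_lt hf S hε
    exact ⟨φ + -f, ⟨φ, hφ, rfl⟩, fun x hx => by simpa [sub_eq_add_neg] using hφ' x hx⟩)
  set ρ := JL2.restrict hF with hρ
  set T := fun ψ => dualCoord hF (ρ ψ) with hT
  set W : ℕ → Set (StrongDual ℝ (JL2 F hF)) := fun m =>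
    {ψ | ψ ∈ C ∧ ‖T ψ - h‖ < 1 / ((m : ℝ) + 1)} with hW
  have hWne : ∀ m, (W m).Nonempty := fun m => by
    obtain ⟨ψ, hψ, -, hψ'⟩ := happ ∅ (1 / ((m : ℝ) + 1)) (by positivity)
    exact ⟨ψ, hψ, hψ'⟩
  have := separableSpace_lp_one
  choose d hdW hd using fun m => exists_seq_dense_image (fun ψ => dualUnit hF (ρ ψ)) (hWne m)
  have hcoord : ∀ m, ∀ ψ ∈ W m, ∀ i, |T ψ i - h i| ≤ 1 / ((m : ℝ) + 1) := fun m ψ hψ i =>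
    (lp.norm_apply_le_norm (by norm_num) (T ψ - h) i).trans hψ.2.le
  have hbound : ∀ m, ∀ ψ ∈ W m, ∀ n, |ρ ψ (JLPre.unit hF n)| ≤ 1 / ((m : ℝ) + 1) := by
    intro m ψ hψ n
    have := hcoord m ψ hψ (Sum.inl n)
    rwa [hinl, sub_zero] at this
  -- The sums over `N` must cancel the limit `h_N` of the residuals.
  set τ : Set ℕ → ℝ := fun N => if hN : N ∈ F then -h (Sum.inr ⟨N, hN⟩) else 0 with hτ
  have hτF : ∀ N : F, τ N = -h (Sum.inr N) := fun N => by simp [hτ]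
  have hτc : (F ∩ {N | τ N ≠ 0}).Countable := by
    have hs := (lp.memℓp h).summable (by norm_num)
    have hc := (hs.countable_support.preimage (Sum.inr_injective (α := ℕ) (β := F))).image
      (Subtype.val : F → Set ℕ)
    refine hc.mono ?_
    rintro N ⟨hN, hne⟩
    refine ⟨⟨N, hN⟩, ?_, rfl⟩
    have : h (Sum.inr ⟨N, hN⟩) ≠ 0 := by
      have := hτF ⟨N, hN⟩
      intro h0
      rw [h0, neg_zero] at this
      exact hne this
    simpa using this
  have hval : ∀ ψ, ∀ N : F, ∑' n, (N : Set ℕ).indicator (fun n => ρ ψ (JLPre.unit hF n)) n =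
      ρ ψ (JLPre.ind hF N) - T ψ (Sum.inr N) := by
    intro ψ N
    rw [hT]
    simp only [dualCoord_inr, residual_apply]
    ring
  obtain ⟨j, hj⟩ := hsel (fun m j n => ρ (d m j) (JLPre.unit hF n))
    (fun m j => (summable_unit hF _).tendsto_atTop_zero)
    (fun m j n => hbound m _ (hdW m j) n) τ hτc (by
      intro m S hS ε hε
      obtain ⟨k, hk⟩ := exists_nat_one_div_lt (show 0 < ε / 3 by positivity)
      -- The minimum puts `ψ` into `W m` as well. The three errors `ε / 3` come from the value at
      -- `χ_N`, from the residual, and from replacing `ψ` by `d m j`.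
      obtain ⟨ψ, hψC, hψ1, hψ2⟩ := happ
        (S.attach.image fun N : S => ((JLPre.ind hF ⟨N.1, hS N.2⟩ : JLPre F hF) : JL2 F hF))
        (min (ε / 3) (1 / ((m : ℝ) + 1))) (by positivity)
      obtain ⟨j, hj⟩ := hd m ψ ⟨hψC, hψ2.trans_le (min_le_right _ _)⟩ (ε / 3) (by positivity)
      refine ⟨j, fun N hN => ?_⟩
      have hNF := hS hN
      have h1 : |ρ ψ (JLPre.ind hF ⟨N, hNF⟩)| < ε / 3 :=
        (hψ1 _ (Finset.mem_image.2 ⟨⟨N, hN⟩, Finset.mem_attach _ _, rfl⟩)).trans_le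
          (min_le_left _ _)
      have h2 : |T ψ (Sum.inr ⟨N, hNF⟩) - h (Sum.inr ⟨N, hNF⟩)| < ε / 3 :=
        (lp.norm_apply_le_norm (by norm_num) (T ψ - h) _).trans_lt
          (hψ2.trans_le (min_le_left _ _))
      have h3 : |∑' n, N.indicator (fun n => ρ ψ (JLPre.unit hF n)) n -
          ∑' n, N.indicator (fun n => ρ (d m j) (JLPre.unit hF n)) n| < ε / 3 :=
        (abs_tsum_indicator_sub_le hF _ _ N).trans_lt (by rwa [dist_eq_norm] at hj)
      have h4 := hval ψ ⟨N, hNF⟩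
      have h5 := hτF ⟨N, hNF⟩
      simp only at h4 h5
      rw [h4] at h3
      rw [h5]
      rw [abs_lt] at *
      constructor <;> linarith)
  have hlim0 := tendsto_one_div_add_atTop_nhds_zero_nat (𝕜 := ℝ)
  have hψlim := JL2.tendsto_zero hF (u := fun m => d m (j m)) (fun m => hR _ (hdW m _).1)
    (fun n => squeeze_zero_norm (fun m => hbound m _ (hdW m (j m)) n) hlim0)
    (fun N => by
      have h1 := hj N N.2
      rw [hτF] at h1
      have h2 : Tendsto (fun m => T (d m (j m)) (Sum.inr N) - h (Sum.inr N)) atTop (𝓝 0) :=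
        squeeze_zero_norm (fun m => hcoord m _ (hdW m (j m)) _) hlim0
      -- The value at `χ_N` is the sum over `N`, tending to `-h_N`, plus the residual, tending to
      -- `h_N`.
      have h3 := h1.add (h2.add_const (h (Sum.inr N)))
      simp only [hval] at h3
      simpa using h3)
  refine ⟨fun m => d m (j m) + f, fun m => ?_, ?_⟩
  · obtain ⟨φ, hφ, hφ'⟩ := (hdW m (j m)).1
    have : d m (j m) + f = φ := by
      rw [← hφ']
      simp
    simpa only [this] using hφ
  · rw [tendsto_iff_forall_eval_tendsto_topDualPairing]
    intro x
    have := (hψlim x).add_const (f x)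
    rw [zero_add] at this
    exact this

end JohnsonLindenstrauss

theorem mainTheorem1 (CH : Cardinal.aleph.{0} 1 = Cardinal.continuum.{0}) :
    ∃ (F : Set (Set ℕ)) (hF : IsMADFamily F),
      F.Infinite ∧ HasEfremovProperty (JohnsonLindenstrauss.JL2 F hF.prop) := by
  obtain ⟨F, hMAD, hinf, hsel⟩ := exists_isMADFamily_selection CH
  exact ⟨F, hMAD, hinf, JohnsonLindenstrauss.hasEfremovProperty_of_selection hMAD.prop hsel⟩
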